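/- Let $\mathbf{FdContraction}$ be the category whose objects are the finite-dimensional complex Hilbert spaces and whose morphisms $A\to B$ are the contractions, i.e. the linear maps $f$ with $\|f(a)\|\le\|a\|$ for all $a\in A$. It is symmetric monoidal under the orthogonal direct sum $\oplus$, with unit $\{0\}$. For a linear map $f : A\oplus U\to B\oplus U$ let $f_{BA}:A\to B$, $f_{BU}:U\to B$, $f_{UA}:A\to U$ and $f_{UU}:U\to U$ be its matrix components. The execution formula is the partial operator which assigns to a morphism $f : A\oplus U\to B\oplus U$ of $\mathbf{FdContraction}$ the sum $$\mathrm{ex}^U(f)=\Sigma\big(\{f_{BA}\}\uplus\{f_{BU}\,f_{UU}^{\,n}\,f_{UA}\}_{n\in\mathbb N}\big),$$ where $\Sigma$ is the limit, in the operator norm, of the net of finite partial sums; $\mathrm{ex}^U(f)$ is defined if this limit exists and is a contraction $A\to B$. The kernel-image trace $\mathrm{Tr}_{\mathrm{ki}}^U(f)$ of a linear map $f : A\oplus U\to B\oplus U$ between finite-dimensional Hilbert spaces is defined if there are linear maps $i:A\to U$ and $k:U\to B$ with $(\mathrm{id}_U-f_{UU})\,i=f_{UA}$ and $k\,(\mathrm{id}_U-f_{UU})=f_{BU}$,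 and its value is then $f_{BA}+k f_{UA}=f_{BA}+f_{BU}\,i$, which does not depend on the choice of $(k,i)$. **Theorem.** $(\mathbf{FdContraction},\oplus,\mathrm{ex})$ is a totally traced monoidal category. That is, $\mathrm{ex}^U(f)$ is defined for every morphism $f:A\oplus U\to B\oplus U$ of $\mathbf{FdContraction}$, and the following hold for all objects and all morphisms of $\mathbf{FdContraction}$ of the types indicated, where $\rho$, $\alpha$, $\sigma$ are the right unitor, the associator $(X\oplus Y)\oplus Z\to X\oplus(Y\oplus Z)$ and the symmetry: * naturality: $h\circ \mathrm{ex}^U(f)\circ g=\mathrm{ex}^U((h\oplus\mathrm{id}_U)\circ f\circ(g\oplus\mathrm{id}_U))$ for $f:A\oplus U\to B\oplus U$, $g:A'\to A$, $h:B\to B'$; * dinaturality: $\mathrm{ex}^U((\mathrm{id}_B\oplus g)\circ f)=\mathrm{ex}^{U'}(f\circ(\mathrm{id}_A\oplus g))$ for $f:A\oplus U\to B\oplus U'$, $g:U'\to U$; * superposing: $g\oplus \mathrm{ex}^U(f)=\mathrm{ex}^U(\alpha^{-1}\circ(g\oplus f)\circ\alpha)$ for $f:A\oplus U\to B\oplus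 U$, $g:C\to D$; * vanishing I: $\mathrm{ex}^{\{0\}}(f)=\rho\circ f\circ\rho^{-1}$ for $f:A\oplus\{0\}\to B\oplus\{0\}$; * vanishing II: $\mathrm{ex}^U(\mathrm{ex}^V(f))=\mathrm{ex}^{U\oplus V}(\alpha\circ f\circ\alpha^{-1})$ for $f:(A\oplus U)\oplus V\to (B\oplus U)\oplus V$; * yanking: $\mathrm{ex}^U(\sigma_{U,U})=\mathrm{id}_U$. Moreover, for every contraction $f:A\oplus U\to B\oplus U$ between finite-dimensional Hilbert spaces, the net of finite partial sums of the family $\{f_{BA}\}\uplus\{f_{BU}f_{UU}^{\,n}f_{UA}\}_{n\in\mathbb N}$ converges in the operator norm, $\mathrm{Tr}_{\mathrm{ki}}^U(f)$ is defined and is equal to its limit, and this limit is again a contraction. -/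

import Mathlib

open CategoryTheory MonoidalCategory

universe u v w

noncomputable section

/-! ### Traced monoidal categories -/

/-- A (total) family of operators `Tr : C(A ⊗ U, B ⊗ U) → C(A, B)` on a symmetric monoidal category
is a trace if it satisfies naturality, dinaturality, superposing, vanishing I and II, and yanking.
The coherence isomorphisms are written out. -/
structure IsTrace {C : Type u} [Category.{v} C] [MonoidalCategory C] [SymmetricCategory C]
    (Tr : ∀ {A B U : C}, (A ⊗ U ⟶ B ⊗ U) → (A ⟶ B)) : Prop where
  naturality : ∀ {A A' B B' U : C} (f : A ⊗ U ⟶ B ⊗ U) (g : A' ⟶ A) (h : B ⟶ B'),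
    g ≫ Tr f ≫ h = Tr ((g ▷ U) ≫ f ≫ (h ▷ U))
  dinaturality : ∀ {A B U U' : C} (f : A ⊗ U ⟶ B ⊗ U') (g : U' ⟶ U),
    Tr (f ≫ (B ◁ g)) = Tr ((A ◁ g) ≫ f)
  superposing : ∀ {A B C' D U : C} (f : A ⊗ U ⟶ B ⊗ U) (g : C' ⟶ D),
    (g ⊗ₘ Tr f) = Tr ((α_ C' A U).hom ≫ (g ⊗ₘ f) ≫ (α_ D B U).inv)
  vanishing_one : ∀ {A B : C} (f : A ⊗ 𝟙_ C ⟶ B ⊗ 𝟙_ C),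
    Tr f = (ρ_ A).inv ≫ f ≫ (ρ_ B).hom
  vanishing_two : ∀ {A B U V : C} (f : (A ⊗ U) ⊗ V ⟶ (B ⊗ U) ⊗ V),
    Tr (Tr f) = Tr ((α_ A U V).inv ≫ f ≫ (α_ B U V).hom)
  yanking : ∀ U : C, Tr (β_ U U).hom = 𝟙 U

/-- A family of partial operators `C(A ⊗ U, B ⊗ U) ⇀ C(A, B)` makes the symmetric monoidal
category `C` totally traced if every operator is everywhere defined and the resulting family of
total operators is a trace. -/
def IsTotallyTraced (C : Type u) [Category.{v} C] [MonoidalCategory C] [SymmetricCategory C]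
    (Tr : ∀ {A B U : C}, (A ⊗ U ⟶ B ⊗ U) →. (A ⟶ B)) : Prop :=
  ∃ h : ∀ {A B U : C} (f : A ⊗ U ⟶ B ⊗ U), (Tr f).Dom,
    IsTrace (fun {A B U : C} (f : A ⊗ U ⟶ B ⊗ U) => (Tr f).get (h f))

/-! ### Bounded operators between direct sums of Hilbert spaces -/

section Operators

variable {A : Type u} [NormedAddCommGroup A] [InnerProductSpace ℂ A]
  {B : Type v} [NormedAddCommGroup B] [InnerProductSpace ℂ B]
  {U : Type w} [NormedAddCommGroup U] [InnerProductSpace ℂ U]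

/-- A (weak) contraction. -/
def IsContraction (f : A →L[ℂ] B) : Prop := ∀ a, ‖f a‖ ≤ ‖a‖

namespace DirectSum2

/-- The projection `A ⊕ B → A`. -/
def fst (A : Type u) [NormedAddCommGroup A] [InnerProductSpace ℂ A]
    (B : Type v) [NormedAddCommGroup B] [InnerProductSpace ℂ B] : WithLp 2 (A × B) →L[ℂ] A :=
  WithLp.fstL 2 ℂ A B

/-- The projection `A ⊕ B → B`. -/
def snd (A : Type u) [NormedAddCommGroup A] [InnerProductSpace ℂ A]
    (B : Type v) [NormedAddCommGroup B] [InnerProductSpace ℂ B] : WithLp 2 (A × B) →L[ℂ] B :=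
  WithLp.sndL 2 ℂ A B

/-- The map `x ↦ (f x, g x)` into the direct sum. -/
def pair (f : U →L[ℂ] A) (g : U →L[ℂ] B) : U →L[ℂ] WithLp 2 (A × B) :=
  (WithLp.prodContinuousLinearEquiv 2 ℂ A B).symm.toContinuousLinearMap.comp (f.prod g)

/-- The injection `A → A ⊕ B`. -/
def inl (A : Type u) [NormedAddCommGroup A] [InnerProductSpace ℂ A]
    (B : Type v) [NormedAddCommGroup B] [InnerProductSpace ℂ B] : A →L[ℂ] WithLp 2 (A × B) :=
  pair (ContinuousLinearMap.id ℂ A) 0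

/-- The injection `B → A ⊕ B`. -/
def inr (A : Type u) [NormedAddCommGroup A] [InnerProductSpace ℂ A]
    (B : Type v) [NormedAddCommGroup B] [InnerProductSpace ℂ B] : B →L[ℂ] WithLp 2 (A × B) :=
  pair 0 (ContinuousLinearMap.id ℂ B)

@[simp] theorem fst_apply (x : WithLp 2 (A × B)) : fst A B x = x.fst := rfl
@[simp] theorem snd_apply (x : WithLp 2 (A × B)) : snd A B x = x.snd := rfl
@[simp] theorem pair_fst (f : U →L[ℂ] A) (g : U →L[ℂ] B) (x : U) : (pair f g x).fst = f x := rfl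
@[simp] theorem pair_snd (f : U →L[ℂ] A) (g : U →L[ℂ] B) (x : U) : (pair f g x).snd = g x := rfl

theorem norm_le_iff {X : Type u} [NormedAddCommGroup X] {Y : Type v} [NormedAddCommGroup Y]
    {x : X} {y : Y} : ‖x‖ ≤ ‖y‖ ↔ ‖x‖ ^ 2 ≤ ‖y‖ ^ 2 :=
  (pow_le_pow_iff_left₀ (norm_nonneg _) (norm_nonneg _) two_ne_zero).symm

end DirectSum2

open DirectSum2

/-- The component `f_BA : A → B` of `f : A ⊕ U → B ⊕ U`. -/
def compBA (f : WithLp 2 (A × U) →L[ℂ] WithLp 2 (B × U)) : A →L[ℂ] B :=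
  fst B U ∘L f ∘L inl A U

/-- The component `f_BU : U → B` of `f : A ⊕ U → B ⊕ U`. -/
def compBU (f : WithLp 2 (A × U) →L[ℂ] WithLp 2 (B × U)) : U →L[ℂ] B :=
  fst B U ∘L f ∘L inr A U

/-- The component `f_UA : A → U` of `f : A ⊕ U → B ⊕ U`. -/
def compUA (f : WithLp 2 (A × U) →L[ℂ] WithLp 2 (B × U)) : A →L[ℂ] U :=
  snd B U ∘L f ∘L inl A U

/-- The component `f_UU : U → U` of `f : A ⊕ U → B ⊕ U`. -/
def compUU (f : WithLp 2 (A × U) →L[ℂ] WithLp 2 (B × U)) : U →L[ℂ] U :=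
  snd B U ∘L f ∘L inr A U

/-- The family `{f_BA} ⊎ {f_BU f_UU ^ n f_UA}_{n ∈ ℕ}` of the execution formula. -/
def exFamily (f : WithLp 2 (A × U) →L[ℂ] WithLp 2 (B × U)) : Unit ⊕ ℕ → (A →L[ℂ] B) :=
  Sum.elim (fun _ => compBA f) (fun n => compBU f ∘L (compUU f ^ n) ∘L compUA f)

/-- `(k, i)` witnesses the kernel-image trace of `f : A ⊕ U → B ⊕ U`. -/
def KiWitness (f : WithLp 2 (A × U) →L[ℂ] WithLp 2 (B × U)) (k : U →L[ℂ] B) (i : A →L[ℂ] U) :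
    Prop :=
  (ContinuousLinearMap.id ℂ U - compUU f) ∘L i = compUA f ∧
    k ∘L (ContinuousLinearMap.id ℂ U - compUU f) = compBU f

/-- The kernel-image trace, a partial operator: it is defined on `f` if `f` has a witness `(k, i)`,
with value `f_BA + k f_UA`. -/
def kiTrace : (WithLp 2 (A × U) →L[ℂ] WithLp 2 (B × U)) →. (A →L[ℂ] B) := fun f =>
  ⟨∃ k i, KiWitness f k i, fun h => compBA f + h.choose ∘L compUA f⟩

/-- The value of the kernel-image trace does not depend on the witness, and it is also
`f_BA + f_BU i`. -/
theorem KiWitness.mem_kiTrace {f : WithLp 2 (A × U) →L[ℂ] WithLp 2 (B × U)} {k : U →L[ℂ] B}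
    {i : A →L[ℂ] U} (h : KiWitness f k i) :
    compBA f + k ∘L compUA f ∈ kiTrace f ∧
      compBA f + k ∘L compUA f = compBA f + compBU f ∘L i := by
  have key : ∀ k' : U →L[ℂ] B, k' ∘L (ContinuousLinearMap.id ℂ U - compUU f) = compBU f →
      k' ∘L compUA f = compBU f ∘L i := by
    intro k' hk'
    rw [← h.1, ← hk', ContinuousLinearMap.comp_assoc]
  have hex : ∃ k i, KiWitness f k i := ⟨k, i, h⟩
  refine ⟨⟨hex, ?_⟩, by rw [key k h.2]⟩
  have h' := hex.choose_spec.choose_spec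
  change compBA f + hex.choose ∘L compUA f = _
  rw [key _ h'.2, key k h.2]

end Operators

/-! ### The symmetric monoidal category of finite-dimensional Hilbert spaces and contractions -/

/-- The objects: finite-dimensional complex Hilbert spaces (completeness is automatic). -/
structure FdContraction : Type (u + 1) where
  carrier : Type u
  [normedAddCommGroup : NormedAddCommGroup carrier]
  [innerProductSpace : InnerProductSpace ℂ carrier]
  [finiteDimensional : FiniteDimensional ℂ carrier]

namespace FdContraction

open DirectSum2

instance : CoeSort FdContraction.{u} (Type u) := ⟨carrier⟩

attribute [instance] normedAddCommGroup innerProductSpace finiteDimensional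

/-- The morphisms: contractions. -/
@[ext] structure Hom (A B : FdContraction.{u}) where
  toCLM : A →L[ℂ] B
  isContraction : IsContraction toCLM

instance : Category FdContraction.{u} where
  Hom := Hom
  id A := ⟨ContinuousLinearMap.id ℂ A, fun _ => le_rfl⟩
  comp f g := ⟨g.toCLM ∘L f.toCLM, fun a => (g.isContraction _).trans (f.isContraction a)⟩

/-- The underlying bounded linear map of a morphism. -/
abbrev clm {A B : FdContraction.{u}} (f : A ⟶ B) : A →L[ℂ] B := Hom.toCLM f

theorem hom_ext {A B : FdContraction.{u}} {f g : A ⟶ B} (h : ∀ x, clm f x = clm g x) : f = g :=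
  Hom.ext (ContinuousLinearMap.ext h)

@[simp] theorem clm_id (A : FdContraction.{u}) (x : A) : clm (𝟙 A) x = x := rfl
@[simp] theorem clm_comp {A B C : FdContraction.{u}} (f : A ⟶ B) (g : B ⟶ C) (x : A) :
    clm (f ≫ g) x = clm g (clm f x) := rfl

/-- The direct sum `A ⊕ B`, with inner product `⟪a, a'⟫ + ⟪b, b'⟫`. -/
abbrev sum (A B : FdContraction.{u}) : FdContraction.{u} := ⟨WithLp 2 (A × B)⟩

/-- The zero-dimensional Hilbert space. -/
abbrev zero : FdContraction.{u} := ⟨PUnit⟩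

/-- The direct sum `f ⊕ g` of contractions. -/
def sumMap {A B C D : FdContraction.{u}} (f : A ⟶ B) (g : C ⟶ D) : sum A C ⟶ sum B D :=
  Hom.mk (pair (clm f ∘L fst A C) (clm g ∘L snd A C)) fun x => by
    have h₁ := norm_le_iff.1 (f.isContraction x.fst)
    have h₂ := norm_le_iff.1 (g.isContraction x.snd)
    rw [norm_le_iff, WithLp.prod_norm_sq_eq_of_L2, WithLp.prod_norm_sq_eq_of_L2]
    exact add_le_add h₁ h₂

/-- `(A ⊕ B) ⊕ C ≅ A ⊕ (B ⊕ C)`. -/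
def assoc (A B C : FdContraction.{u}) : sum (sum A B) C ≅ sum A (sum B C) where
  hom := Hom.mk (pair (fst A B ∘L fst (sum A B) C) (pair (snd A B ∘L fst (sum A B) C)
      (snd (sum A B) C))) fun x => by
    rw [norm_le_iff]
    simp only [WithLp.prod_norm_sq_eq_of_L2]
    simp [add_assoc]
  inv := Hom.mk (pair (pair (fst A (sum B C)) (fst B C ∘L snd A (sum B C)))
      (snd B C ∘L snd A (sum B C))) fun x => by
    rw [norm_le_iff]
    simp only [WithLp.prod_norm_sq_eq_of_L2]
    simp [add_assoc]
  hom_inv_id := hom_ext fun _ => rfl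
  inv_hom_id := hom_ext fun _ => rfl

/-- `0 ⊕ A ≅ A`. -/
def leftUnit (A : FdContraction.{u}) : sum zero A ≅ A where
  hom := Hom.mk (snd zero A) fun x => by
    rw [norm_le_iff, WithLp.prod_norm_sq_eq_of_L2]
    simp
  inv := Hom.mk (inr zero A) fun x => by
    rw [norm_le_iff, WithLp.prod_norm_sq_eq_of_L2]
    simp [inr]
  hom_inv_id := hom_ext fun _ => rfl
  inv_hom_id := hom_ext fun _ => rfl

/-- `A ⊕ 0 ≅ A`. -/
def rightUnit (A : FdContraction.{u}) : sum A zero ≅ A where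
  hom := Hom.mk (fst A zero) fun x => by
    rw [norm_le_iff, WithLp.prod_norm_sq_eq_of_L2]
    simp
  inv := Hom.mk (inl A zero) fun x => by
    rw [norm_le_iff, WithLp.prod_norm_sq_eq_of_L2]
    simp [inl]
  hom_inv_id := hom_ext fun _ => rfl
  inv_hom_id := hom_ext fun _ => rfl

/-- The symmetry `A ⊕ B ≅ B ⊕ A`. -/
def swap (A B : FdContraction.{u}) : sum A B ≅ sum B A where
  hom := Hom.mk (pair (snd A B) (fst A B)) fun x => by
    rw [norm_le_iff, WithLp.prod_norm_sq_eq_of_L2, WithLp.prod_norm_sq_eq_of_L2]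
    simp [add_comm]
  inv := Hom.mk (pair (snd B A) (fst B A)) fun x => by
    rw [norm_le_iff, WithLp.prod_norm_sq_eq_of_L2, WithLp.prod_norm_sq_eq_of_L2]
    simp [add_comm]
  hom_inv_id := hom_ext fun _ => rfl
  inv_hom_id := hom_ext fun _ => rfl

instance : MonoidalCategoryStruct FdContraction.{u} where
  tensorObj := sum
  tensorHom f g := sumMap f g
  whiskerLeft A _ _ f := sumMap (𝟙 A) f
  whiskerRight f A := sumMap f (𝟙 A)
  tensorUnit := zero
  associator := assoc
  leftUnitor := leftUnit
  rightUnitor := rightUnit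

instance : MonoidalCategory FdContraction.{u} where
  tensorHom_def _ _ := hom_ext fun _ => rfl
  id_tensorHom_id _ _ := hom_ext fun _ => rfl
  tensorHom_comp_tensorHom _ _ _ _ := hom_ext fun _ => rfl
  whiskerLeft_id _ _ := hom_ext fun _ => rfl
  id_whiskerRight _ _ := hom_ext fun _ => rfl
  associator_naturality _ _ _ := hom_ext fun _ => rfl
  leftUnitor_naturality _ := hom_ext fun _ => rfl
  rightUnitor_naturality _ := hom_ext fun _ => rfl
  pentagon _ _ _ _ := hom_ext fun _ => rfl
  triangle _ _ := hom_ext fun _ => rfl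

instance : SymmetricCategory FdContraction.{u} where
  braiding := swap
  braiding_naturality_right _ _ _ _ := hom_ext fun _ => rfl
  braiding_naturality_left _ _ := hom_ext fun _ => rfl
  hexagon_forward _ _ _ := hom_ext fun _ => rfl
  hexagon_reverse _ _ _ := hom_ext fun _ => rfl
  symmetry _ _ := hom_ext fun _ => rfl

/-- The underlying bounded operator between direct sums of a morphism `A ⊕ U ⟶ B ⊕ U`. -/
abbrev sumClm {A B U : FdContraction.{u}} (f : A ⊗ U ⟶ B ⊗ U) :
    WithLp 2 (A × U) →L[ℂ] WithLp 2 (B × U) := Hom.toCLM f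

/-- The execution formula, a partial operator on contractions: `ex f` is defined, with value the
contraction `g`, if the net of finite partial sums of the family
`{f_BA} ⊎ {f_BU f_UU ^ n f_UA}_{n ∈ ℕ}` converges to `g` in the operator norm. -/
def ex {A B U : FdContraction.{u}} : (A ⊗ U ⟶ B ⊗ U) →. (A ⟶ B) := fun f =>
  ⟨∃ g : A ⟶ B, HasSum (exFamily (sumClm f)) (clm g), fun h => h.choose⟩

theorem mem_ex_iff {A B U : FdContraction.{u}} (f : A ⊗ U ⟶ B ⊗ U) (g : A ⟶ B) :
    g ∈ ex f ↔ HasSum (exFamily (sumClm f)) (clm g) := by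
  constructor
  · rintro ⟨h, rfl⟩
    exact h.choose_spec
  · intro hg
    have h : ∃ g : A ⟶ B, HasSum (exFamily (sumClm f)) (clm g) := ⟨g, hg⟩
    exact ⟨h, Hom.ext (h.choose_spec.unique hg)⟩

end FdContraction

end

/-!
A morphism `f : A ⊕ U → B ⊕ U` is read as the feedback equation `f (a, x) = (b, x)`. For a
contraction, its solutions `x` may fail to be unique, but `b` depends only on `a`: if `(b, x)` and
`(c, y)` both solve it, then `f` sends `(0, x - y)` to `(b - c, x - y)`, which forces `b = c`.
Every trace axiom is then an exchange of solutions between two feedback equations.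

Convergence comes from splitting `U` along the unimodular eigenvectors of `T = f_UU`. A contraction
that preserves the norm of a vector preserves its inner products with all vectors. Hence the span
of these eigenvectors reduces `T`, is killed by `f_BU` and is orthogonal to the range of `f_UA`.
On its orthogonal complement `T` has spectral radius less than one, and with the orthogonal
projection `P` onto that complement, `N = ∑ Tⁿ P` satisfies `(1 - T) N = P = N (1 - T)`.
Hence `(f_BU N, N f_UA)` is a witness for the kernel-image trace, with value
`f_BA + f_BU N f_UA = f_BA + ∑ f_BU Tⁿ f_UA`.
-/

open Filter DirectSum2
open Module.End (HasEigenvalue eigenspace invtSubmodule mem_eigenspace_iff)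

section Defect

variable {𝕜 X Y : Type*} [RCLike 𝕜] [NormedAddCommGroup X] [InnerProductSpace 𝕜 X]
  [NormedAddCommGroup Y] [InnerProductSpace 𝕜 Y]

/-- The defect form `⟪x, y⟫ - ⟪g x, g y⟫` of a contraction `g`, as a semi-inner product. Encoding it
as a core gives access to the Cauchy–Schwarz inequality. -/
abbrev defectCore (g : X →ₗ[𝕜] Y) (hg : ∀ x, ‖g x‖ ≤ ‖x‖) : PreInnerProductSpace.Core 𝕜 X where
  inner x y := inner 𝕜 x y - inner 𝕜 (g x) (g y)
  conj_inner_symm x y := by simp only [map_sub, inner_conj_symm]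
  re_inner_nonneg x := by
    simpa only [map_sub, inner_self_eq_norm_sq, sub_nonneg] using norm_le_iff.1 (hg x)
  add_left x y z := by simp only [map_add, inner_add_left]; ring
  smul_left x y r := by simp only [map_smul, inner_smul_left]; ring

theorem inner_map_map_of_norm_map_eq {g : X →ₗ[𝕜] Y} (hg : ∀ x, ‖g x‖ ≤ ‖x‖) {v : X}
    (hv : ‖g v‖ = ‖v‖) (x : X) : inner 𝕜 (g v) (g x) = inner 𝕜 v x := by
  let c := defectCore g hg
  have cauchy_schwarz := InnerProductSpace.Core.inner_mul_inner_self_le (c := c) v x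
  have defect_self : RCLike.re (c.inner v v) = 0 := by
    change RCLike.re (inner 𝕜 v v - inner 𝕜 (g v) (g v)) = 0
    rw [map_sub, inner_self_eq_norm_sq, inner_self_eq_norm_sq, hv, sub_self]
  rw [InnerProductSpace.Core.norm_inner_symm (c := c) x v] at cauchy_schwarz
  change ‖c.inner v x‖ * ‖c.inner v x‖ ≤ RCLike.re (c.inner v v) * _ at cauchy_schwarz
  rw [defect_self, zero_mul] at cauchy_schwarz
  have defect_eq_zero : c.inner v x = 0 :=
    norm_eq_zero.1 (mul_self_eq_zero.1 (cauchy_schwarz.antisymm (mul_self_nonneg _)))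
  exact (sub_eq_zero.1 defect_eq_zero).symm

end Defect

section NeumannSeries

theorem summable_pow_of_spectralRadius_lt_one {R : Type*} [NormedRing R] [NormedAlgebra ℂ R]
    [CompleteSpace R] {a : R} (ha : spectralRadius ℂ a < 1) : Summable fun n : ℕ => a ^ n := by
  obtain ⟨r, har, hr⟩ := ENNReal.lt_iff_exists_nnreal_btwn.1 ha
  have hr_lt_one : (r : ℝ) < 1 := by exact_mod_cast hr
  have root_lt : ∀ᶠ n : ℕ in atTop, (‖a ^ n‖₊ : ENNReal) ^ (1 / n : ℝ) < r :=
    (spectrum.pow_nnnorm_pow_one_div_tendsto_nhds_spectralRadius a).eventually_lt_const har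
  refine .of_norm_bounded_eventually_nat (summable_geometric_of_lt_one r.coe_nonneg hr_lt_one) ?_
  filter_upwards [root_lt, eventually_ne_atTop 0] with n hn hn0
  rw [one_div] at hn
  have hpow := ENNReal.pow_le_pow_left hn.le (n := n)
  rw [ENNReal.rpow_inv_natCast_pow hn0] at hpow
  exact_mod_cast hpow

theorem summable_pow_of_forall_hasEigenvalue {V : Type*} [NormedAddCommGroup V] [NormedSpace ℂ V]
    [FiniteDimensional ℂ V] {T : V →L[ℂ] V}
    (hT : ∀ μ, HasEigenvalue (T : Module.End ℂ V) μ → ‖μ‖ < 1) :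
    Summable fun n : ℕ => T ^ n := by
  have := FiniteDimensional.complete ℂ V
  apply summable_pow_of_spectralRadius_lt_one
  rcases subsingleton_or_nontrivial V with hV | hV
  · rw [Subsingleton.elim T 0, spectrum.spectralRadius_zero]
    exact zero_lt_one
  · refine spectrum.spectralRadius_lt_of_forall_lt T (r := 1) fun μ hμ => ?_
    have hμ_end : μ ∈ spectrum ℂ (T : Module.End ℂ V) := by
      rwa [← AlgEquiv.spectrum_eq (Module.End.toContinuousLinearMap V)]
    exact_mod_cast hT μ (Module.End.hasEigenvalue_iff_mem_spectrum.2 hμ_end)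

variable {R : Type*} [Ring R] [TopologicalSpace R] [IsTopologicalRing R] {a p s : R}

theorem summable_pow_mul_of_commute (hap : Commute a p) (hp : IsIdempotentElem p)
    (h : Summable fun n : ℕ => (a * p) ^ n) : Summable fun n : ℕ => a ^ n * p := by
  refine (h.mul_right p).congr fun n => ?_
  rw [hap.mul_pow, mul_assoc, ← pow_succ, hp.pow_succ_eq]

variable [T2Space R]

theorem one_sub_mul_eq_of_hasSum_pow_mul (h : HasSum (fun n : ℕ => a ^ n * p) s) :
    (1 - a) * s = p := by
  have tail : HasSum (fun n : ℕ => a ^ (n + 1) * p) (s - p) := by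
    simpa using (hasSum_nat_add_iff' 1).2 h
  have hs : a * s = s - p :=
    (h.mul_left a).unique (by simpa only [pow_succ', mul_assoc] using tail)
  rw [sub_mul, one_mul, hs, sub_sub_cancel]

theorem mul_one_sub_eq_of_hasSum_pow_mul (hap : Commute a p)
    (h : HasSum (fun n : ℕ => a ^ n * p) s) : s * (1 - a) = p := by
  have commute_s : Commute a s := by
    rw [← h.tsum_eq]
    exact Commute.tsum_right a fun n => (Commute.self_pow a n).mul_right hap
  rw [← ((Commute.one_left s).sub_left commute_s).eq, one_sub_mul_eq_of_hasSum_pow_mul h]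

end NeumannSeries

section UnitaryPart

variable {U : Type*} [NormedAddCommGroup U] [InnerProductSpace ℂ U] {T : U →L[ℂ] U}

/-- The span of the eigenvectors of `T` with unimodular eigenvalue. For a contraction on a
finite-dimensional space this is the largest reducing subspace on which it is unitary. -/
def unitaryPart (T : U →L[ℂ] U) : Submodule ℂ U :=
  ⨆ μ : Circle, eigenspace (T : Module.End ℂ U) μ

theorem mem_unitaryPart_of_apply_eq_smul {μ : ℂ} (hμ : ‖μ‖ = 1) {v : U} (hv : T v = μ • v) :
    v ∈ unitaryPart T :=
  Submodule.mem_iSup_of_mem (⟨μ, mem_sphere_zero_iff_norm.2 hμ⟩ : Circle) (mem_eigenspace_iff.2 hv)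

theorem unitaryPart_le_iff {K : Submodule ℂ U} :
    unitaryPart T ≤ K ↔ ∀ (μ : Circle) (v : U), T v = (μ : ℂ) • v → v ∈ K := by
  rw [unitaryPart, iSup_le_iff]
  simp only [SetLike.le_def, mem_eigenspace_iff, ContinuousLinearMap.coe_coe]

theorem mem_orthogonal_unitaryPart_iff {x : U} :
    x ∈ (unitaryPart T)ᗮ ↔ ∀ (μ : Circle) (v : U), T v = (μ : ℂ) • v → inner ℂ v x = 0 := by
  simp only [unitaryPart, ← Submodule.iInf_orthogonal, Submodule.mem_iInf,
    Submodule.mem_orthogonal, mem_eigenspace_iff, ContinuousLinearMap.coe_coe]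

theorem unitaryPart_mem_invtSubmodule : unitaryPart T ∈ invtSubmodule (T : Module.End ℂ U) :=
  unitaryPart_le_iff.2 fun μ v hv => by
    change T v ∈ unitaryPart T
    rw [hv]
    exact Submodule.smul_mem _ _ (mem_unitaryPart_of_apply_eq_smul (Circle.norm_coe μ) hv)

theorem IsContraction.orthogonal_unitaryPart_mem_invtSubmodule (hT : IsContraction T) :
    (unitaryPart T)ᗮ ∈ invtSubmodule (T : Module.End ℂ U) := fun x hx =>
  mem_orthogonal_unitaryPart_iff.2 fun μ v hv => by
    have norm_eq : ‖T v‖ = ‖v‖ := by rw [hv, norm_smul, Circle.norm_coe, one_mul]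
    have inner_eq : inner ℂ (T v) (T x) = inner ℂ v x :=
      inner_map_map_of_norm_map_eq (g := (T : U →ₗ[ℂ] U)) hT norm_eq x
    rw [mem_orthogonal_unitaryPart_iff.1 hx μ v hv, hv, inner_smul_left] at inner_eq
    exact (mul_eq_zero.1 inner_eq).resolve_left ((map_ne_zero _).2 μ.coe_ne_zero)

variable [FiniteDimensional ℂ U]

theorem IsContraction.commute_starProjection_orthogonal_unitaryPart (hT : IsContraction T) :
    Commute T (unitaryPart T)ᗮ.starProjection := by
  refine ((ContinuousLinearMap.IsIdempotentElem.commute_iff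
    (unitaryPart T)ᗮ.isIdempotentElem_starProjection).2 ⟨?_, ?_⟩).symm
  · rw [Submodule.range_starProjection]
    exact hT.orthogonal_unitaryPart_mem_invtSubmodule
  · rw [Submodule.ker_starProjection, Submodule.orthogonal_orthogonal]
    exact unitaryPart_mem_invtSubmodule

theorem IsContraction.norm_lt_one_of_hasEigenvalue_mul_starProjection (hT : IsContraction T) {μ : ℂ}
    (hμ : HasEigenvalue ((T * (unitaryPart T)ᗮ.starProjection : U →L[ℂ] U) : Module.End ℂ U) μ) :
    ‖μ‖ < 1 := by
  set K := (unitaryPart T)ᗮ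
  obtain ⟨x, hx_eigen, hx0⟩ := hμ.exists_hasEigenvector
  replace hx_eigen : T (K.starProjection x) = μ • x := mem_eigenspace_iff.1 hx_eigen
  by_contra! one_le
  have hμ0 : μ ≠ 0 := norm_pos_iff.1 (one_pos.trans_le one_le)
  have hxK : x ∈ K := by
    rw [← K.smul_mem_iff hμ0, ← hx_eigen]
    exact hT.orthogonal_unitaryPart_mem_invtSubmodule (K.starProjection_apply_mem x)
  rw [Submodule.starProjection_eq_self_iff.2 hxK] at hx_eigen
  have le_one : ‖μ‖ ≤ 1 := by
    refine le_of_mul_le_mul_right ?_ (norm_pos_iff.2 hx0)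
    rw [← norm_smul, ← hx_eigen, one_mul]
    exact hT x
  exact hx0 ((Submodule.orthogonal_disjoint _).le_bot
    ⟨mem_unitaryPart_of_apply_eq_smul (le_one.antisymm one_le) hx_eigen, hxK⟩)

theorem IsContraction.summable_pow_mul_starProjection (hT : IsContraction T) :
    Summable fun n : ℕ => T ^ n * (unitaryPart T)ᗮ.starProjection :=
  summable_pow_mul_of_commute hT.commute_starProjection_orthogonal_unitaryPart
    (unitaryPart T)ᗮ.isIdempotentElem_starProjection
    (summable_pow_of_forall_hasEigenvalue fun _ =>
      hT.norm_lt_one_of_hasEigenvalue_mul_starProjection)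

end UnitaryPart

section Feedback

variable {A B U : Type*} [NormedAddCommGroup A] [InnerProductSpace ℂ A]
  [NormedAddCommGroup B] [InnerProductSpace ℂ B] [NormedAddCommGroup U] [InnerProductSpace ℂ U]
  {f : WithLp 2 (A × U) →L[ℂ] WithLp 2 (B × U)}

theorem map_toLp_eq_components (f : WithLp 2 (A × U) →L[ℂ] WithLp 2 (B × U)) (a : A) (x : U) :
    f (WithLp.toLp 2 (a, x)) =
      WithLp.toLp 2 (compBA f a + compBU f x, compUA f a + compUU f x) := by
  have split : WithLp.toLp 2 (a, x) = inl A U a + inr A U x := by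
    apply WithLp.ofLp_injective 2
    ext <;> simp [inl, inr, pair]
  rw [split, map_add]
  rfl

theorem IsContraction.norm_sq_compBU_add_le (hf : IsContraction f) (x : U) :
    ‖compBU f x‖ ^ 2 + ‖compUU f x‖ ^ 2 ≤ ‖x‖ ^ 2 := by
  have h := norm_le_iff.1 (hf (WithLp.toLp 2 (0, x)))
  rw [map_toLp_eq_components, WithLp.prod_norm_sq_eq_of_L2, WithLp.prod_norm_sq_eq_of_L2] at h
  simpa using h

theorem isContraction_compUU (hf : IsContraction f) : IsContraction (compUU f) := fun x =>
  norm_le_iff.2 (le_of_add_le_of_nonneg_right (hf.norm_sq_compBU_add_le x) (sq_nonneg _))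

theorem IsContraction.unitaryPart_le_ker_compBU (hf : IsContraction f) :
    unitaryPart (compUU f) ≤ (compBU f).ker :=
  unitaryPart_le_iff.2 fun μ v hv => by
    have h := hf.norm_sq_compBU_add_le v
    rw [hv, norm_smul, Circle.norm_coe, one_mul, add_le_iff_nonpos_left] at h
    exact norm_eq_zero.1 (pow_eq_zero_iff two_ne_zero |>.1 (h.antisymm (sq_nonneg _)))

theorem IsContraction.compUA_mem_orthogonal_unitaryPart (hf : IsContraction f) (a : A) :
    compUA f a ∈ (unitaryPart (compUU f))ᗮ :=
  mem_orthogonal_unitaryPart_iff.2 fun μ v hv => by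
    have hBU : compBU f v = 0 :=
      hf.unitaryPart_le_ker_compBU (mem_unitaryPart_of_apply_eq_smul (Circle.norm_coe μ) hv)
    have map_v : f (WithLp.toLp 2 (0, v)) = WithLp.toLp 2 (0, (μ : ℂ) • v) := by
      simp [map_toLp_eq_components, hBU, hv]
    have norm_eq : ‖f (WithLp.toLp 2 (0, v))‖ = ‖WithLp.toLp 2 ((0 : A), v)‖ := by
      simp [map_v, norm_smul, Circle.norm_coe]
    have inner_eq := inner_map_map_of_norm_map_eq
      (g := (f : WithLp 2 (A × U) →ₗ[ℂ] WithLp 2 (B × U))) hf norm_eq (WithLp.toLp 2 (a, 0))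
    simpa [map_v, map_toLp_eq_components, inner_smul_left] using inner_eq

/-- The feedback relation of `f : A ⊕ U → B ⊕ U`: on input `a`, some internal state `x` that `f`
reproduces yields the output `b`. -/
def Feedback (f : WithLp 2 (A × U) →L[ℂ] WithLp 2 (B × U)) (a : A) (b : B) : Prop :=
  ∃ x : U, f (WithLp.toLp 2 (a, x)) = WithLp.toLp 2 (b, x)

theorem feedback_of_mem_kiTrace {t : A →L[ℂ] B} (ht : t ∈ kiTrace f) (a : A) :
    Feedback f a (t a) := by
  obtain ⟨k, i, hki⟩ := ht.fst
  rw [Part.mem_unique ht hki.mem_kiTrace.1, hki.mem_kiTrace.2]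
  have hi : i a - compUU f (i a) = compUA f a := DFunLike.congr_fun hki.1 a
  refine ⟨i a, ?_⟩
  rw [map_toLp_eq_components, ← hi, sub_add_cancel]
  rfl

theorem IsContraction.norm_le_of_feedback (hf : IsContraction f) {a : A} {b : B}
    (h : Feedback f a b) : ‖b‖ ≤ ‖a‖ := by
  obtain ⟨x, hx⟩ := h
  have hle := norm_le_iff.1 (hf (WithLp.toLp 2 (a, x)))
  rw [hx, WithLp.prod_norm_sq_eq_of_L2, WithLp.prod_norm_sq_eq_of_L2] at hle
  exact norm_le_iff.2 (le_of_add_le_add_right hle)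

theorem Feedback.sub {a a' : A} {b b' : B} (h : Feedback f a b) (h' : Feedback f a' b') :
    Feedback f (a - a') (b - b') := by
  obtain ⟨x, hx⟩ := h
  obtain ⟨x', hx'⟩ := h'
  exact ⟨x - x', (map_sub f _ _).trans (congrArg₂ _ hx hx')⟩

theorem IsContraction.feedback_unique (hf : IsContraction f) {a : A} {b b' : B}
    (h : Feedback f a b) (h' : Feedback f a b') : b = b' := by
  have hle := hf.norm_le_of_feedback (h.sub h')
  rwa [sub_self, norm_zero, norm_le_zero_iff, sub_eq_zero] at hle

theorem IsContraction.of_mem_kiTrace (hf : IsContraction f) {t : A →L[ℂ] B} (ht : t ∈ kiTrace f) :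
    IsContraction t := fun a =>
  hf.norm_le_of_feedback (feedback_of_mem_kiTrace ht a)

variable [FiniteDimensional ℂ U]

theorem IsContraction.starProjection_comp_compUA (hf : IsContraction f) :
    (unitaryPart (compUU f))ᗮ.starProjection ∘L compUA f = compUA f :=
  ContinuousLinearMap.ext fun a =>
    Submodule.starProjection_eq_self_iff.2 (hf.compUA_mem_orthogonal_unitaryPart a)

theorem IsContraction.compBU_comp_starProjection (hf : IsContraction f) :
    compBU f ∘L (unitaryPart (compUU f))ᗮ.starProjection = compBU f := by
  ext x
  have hx := (unitaryPart (compUU f))ᗮ.sub_starProjection_mem_orthogonal x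
  rw [Submodule.orthogonal_orthogonal] at hx
  have hker : compBU f (x - (unitaryPart (compUU f))ᗮ.starProjection x) = 0 :=
    hf.unitaryPart_le_ker_compBU hx
  rw [map_sub, sub_eq_zero] at hker
  exact hker.symm

variable {N : U →L[ℂ] U}

theorem IsContraction.kiWitness_of_hasSum (hf : IsContraction f)
    (hN : HasSum (fun n : ℕ => compUU f ^ n * (unitaryPart (compUU f))ᗮ.starProjection) N) :
    KiWitness f (compBU f ∘L N) (N ∘L compUA f) := by
  have commute_proj :=
    (isContraction_compUU hf).commute_starProjection_orthogonal_unitaryPart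
  have resolvent_left := one_sub_mul_eq_of_hasSum_pow_mul hN
  have resolvent_right := mul_one_sub_eq_of_hasSum_pow_mul commute_proj hN
  rw [ContinuousLinearMap.mul_def, ContinuousLinearMap.one_def] at resolvent_left resolvent_right
  constructor
  · rw [← ContinuousLinearMap.comp_assoc, resolvent_left, hf.starProjection_comp_compUA]
  · rw [ContinuousLinearMap.comp_assoc, resolvent_right, hf.compBU_comp_starProjection]

theorem IsContraction.hasSum_exFamily_of_hasSum (hf : IsContraction f)
    (hN : HasSum (fun n : ℕ => compUU f ^ n * (unitaryPart (compUU f))ᗮ.starProjection) N) :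
    HasSum (exFamily f) (compBA f + (compBU f ∘L N) ∘L compUA f) := by
  refine .sum (hasSum_unique _) ?_
  have term_eq (n : ℕ) : compBU f ∘L (compUU f ^ n) ∘L compUA f =
      compBU f ∘L (compUU f ^ n * (unitaryPart (compUU f))ᗮ.starProjection) ∘L compUA f := by
    rw [ContinuousLinearMap.mul_def, ContinuousLinearMap.comp_assoc, hf.starProjection_comp_compUA]
  refine HasSum.congr_fun ?_ term_eq
  exact ((ContinuousLinearMap.postcomp A (compBU f)).comp
    (ContinuousLinearMap.precomp U (compUA f))).hasSum hN

theorem IsContraction.exists_hasSum_exFamily_mem_kiTrace (hf : IsContraction f) :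
    ∃ t : A →L[ℂ] B, HasSum (exFamily f) t ∧ t ∈ kiTrace f := by
  obtain ⟨N, hN⟩ := (isContraction_compUU hf).summable_pow_mul_starProjection
  exact ⟨_, hf.hasSum_exFamily_of_hasSum hN, (hf.kiWitness_of_hasSum hN).mem_kiTrace.1⟩

end Feedback

namespace FdContraction

variable {A B U : FdContraction.{u}}

theorem exists_mem_ex_mem_kiTrace (f : A ⊗ U ⟶ B ⊗ U) :
    ∃ g ∈ ex f, clm g ∈ kiTrace (sumClm f) := by
  have hf : IsContraction (sumClm f) := Hom.isContraction f
  obtain ⟨t, hsum, hki⟩ := hf.exists_hasSum_exFamily_mem_kiTrace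
  exact ⟨⟨t, hf.of_mem_kiTrace hki⟩, (mem_ex_iff f _).2 hsum, hki⟩

theorem ex_dom (f : A ⊗ U ⟶ B ⊗ U) : (ex f).Dom :=
  let ⟨_, hg, _⟩ := exists_mem_ex_mem_kiTrace f
  Part.dom_iff_mem.2 ⟨_, hg⟩

/-- The execution formula as a total operator. -/
noncomputable def trace (f : A ⊗ U ⟶ B ⊗ U) : A ⟶ B := (ex f).get (ex_dom f)

theorem feedback_trace (f : A ⊗ U ⟶ B ⊗ U) (a : A) : Feedback (sumClm f) a (clm (trace f) a) := by
  obtain ⟨g, hg, hki⟩ := exists_mem_ex_mem_kiTrace f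
  rw [trace, Part.get_eq_of_mem hg]
  exact feedback_of_mem_kiTrace hki a

theorem trace_apply_eq {f : A ⊗ U ⟶ B ⊗ U} {a : A} {b : B} (h : Feedback (sumClm f) a b) :
    clm (trace f) a = b :=
  IsContraction.feedback_unique (f := sumClm f) (Hom.isContraction f) (feedback_trace f a) h

theorem isTrace_trace : IsTrace fun {A B U : FdContraction.{u}} (f : A ⊗ U ⟶ B ⊗ U) => trace f where
  naturality {_ _ _ _ U} f g h := hom_ext fun a => by
    obtain ⟨x, hx⟩ := feedback_trace f (clm g a)
    exact (trace_apply_eq ⟨x, congrArg (clm (h ▷ U)) hx⟩).symm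
  dinaturality {A B _ _} f g := hom_ext fun a => by
    obtain ⟨x, hx⟩ := feedback_trace ((A ◁ g) ≫ f) a
    exact trace_apply_eq ⟨clm g x, congrArg (clm (B ◁ g)) hx⟩
  superposing {_ B _ D U} f g := hom_ext fun c => by
    obtain ⟨x, hx⟩ := feedback_trace f c.snd
    exact (trace_apply_eq ⟨x, congrArg
      (fun y : WithLp 2 (B × U) => clm (α_ D B U).inv (WithLp.toLp 2 (clm g c.fst, y))) hx⟩).symm
  vanishing_one _ := hom_ext fun _ => trace_apply_eq ⟨0, rfl⟩
  vanishing_two {_ B U V} f := hom_ext fun a => by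
    obtain ⟨x, hx⟩ := feedback_trace (trace f) a
    obtain ⟨y, hy⟩ := feedback_trace f (WithLp.toLp 2 (a, x))
    have hxy := hy.trans (congrArg (fun z => WithLp.toLp 2 (z, y)) hx)
    exact (trace_apply_eq ⟨WithLp.toLp 2 (x, y), congrArg (clm (α_ B U V).hom) hxy⟩).symm
  yanking _ := hom_ext fun a => trace_apply_eq ⟨a, rfl⟩

theorem isTotallyTraced_ex : IsTotallyTraced FdContraction.{u} ex := ⟨ex_dom, isTrace_trace⟩

end FdContraction

theorem mainTheorem2_general :
    IsTotallyTraced FdContraction.{u} FdContraction.ex ∧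
    ∀ (A B U : Type*) [NormedAddCommGroup A] [InnerProductSpace ℂ A]
      [NormedAddCommGroup B] [InnerProductSpace ℂ B]
      [NormedAddCommGroup U] [InnerProductSpace ℂ U] [FiniteDimensional ℂ U]
      (f : WithLp 2 (A × U) →L[ℂ] WithLp 2 (B × U)),
      IsContraction f →
        ∃ t : A →L[ℂ] B, HasSum (exFamily f) t ∧ kiTrace f = Part.some t ∧ IsContraction t := by
  refine ⟨FdContraction.isTotallyTraced_ex, fun A B U _ _ _ _ _ _ _ f hf => ?_⟩
  obtain ⟨t, hsum, hki⟩ := hf.exists_hasSum_exFamily_mem_kiTrace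
  exact ⟨t, hsum, Part.eq_some_iff.2 hki, hf.of_mem_kiTrace hki⟩

theorem mainTheorem2 :
    IsTotallyTraced FdContraction.{u} FdContraction.ex ∧
    ∀ (A B U : FdContraction.{u}) (f : WithLp 2 (A × U) →L[ℂ] WithLp 2 (B × U)),
      IsContraction f →
        ∃ t : A →L[ℂ] B, HasSum (exFamily f) t ∧ kiTrace f = Part.some t ∧ IsContraction t :=
  mainTheorem2_general.imp_right fun converges A B U => converges A B U
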